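/- Let $B$ be a separable unital $C^*$-algebra (with $1\neq 0$) and let $\beta\in\mathrm{Aut}(B)$. Write $B_\infty=\ell^\infty(\mathbb{N},B)/c_0(\mathbb{N},B)$, regard $B$ as the subalgebra of (classes of) constant sequences, and let $\beta_\infty$ be the automorphism of $B_\infty$ induced by entrywise application of $\beta$. Say that $\beta$ is \emph{approximately representable} if there is a unitary $v\in (B_\infty)^{\beta_\infty}$, that is, a unitary $v\in B_\infty$ with $\beta_\infty(v)=v$, such that $\beta(b)=vbv^*$ for all $b\in B$. Let $B\rtimes_\beta\mathbb{Z}$ be the crossed product, with canonical unitary $u$ satisfying $ubu^*=\beta(b)$ for $b\in B$, and let $\widehat{\beta}\colon\mathbb{T}\to\mathrm{Aut}(B\rtimes_\beta\mathbb{Z})$ be the dual action, that is, the continuous action with $\widehat{\beta}_\zeta(b)=b$ for $b\in B$ and $\widehat{\beta}_\zeta(u)=\zeta u$ for $\zeta\in\mathbb{T}$. A continuous action $\alpha\colon\mathbb{T}\to\mathrm{Aut}(A)$ on a unital $C^*$-algebra $A$ has the \emph{Rokhlin property} if for every $\varepsilon>0$ and every finite subset $F\subseteq A$ there is a unitary $w\in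 A$ such that $\|\alpha_\zeta(w)-\zeta w\|<\varepsilon$ for all $\zeta\in\mathbb{T}$ and $\|wa-aw\|<\varepsilon$ for all $a\in F$. Then $\beta$ is approximately representable if and only if $\widehat{\beta}$ has the Rokhlin property. -/

import Mathlib

open Filter Topology
open scoped ENNReal

noncomputable section

/-! ### The sequence algebra `A_∞ = ℓ^∞(ℕ, A) / c₀(ℕ, A)` -/

section SequenceAlgebra

variable (A : Type*) [CStarAlgebra A] [Nontrivial A]

/-- `ℓ^∞(ℕ, A)`: bounded sequences with the pointwise operations. -/
abbrev BoundedSeq : Type _ := lp (fun _ : ℕ => A) ∞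

/-- `c₀(ℕ, A)`, as an ideal of `ℓ^∞(ℕ, A)`. -/
def nullSeqIdeal : Ideal (BoundedSeq A) where
  carrier := {a | Tendsto (fun n => ‖a n‖) atTop (𝓝 0)}
  add_mem' {a b} ha hb := by
    refine squeeze_zero (fun n => norm_nonneg _) (fun n => ?_) (by simpa using Tendsto.add ha hb)
    simpa using norm_add_le (a n) (b n)
  zero_mem' := by simp
  smul_mem' c a ha := by
    refine squeeze_zero (fun n => norm_nonneg _) (fun n => ?_)
      (by simpa using Tendsto.const_mul ‖c‖ ha)
    have h1 : ‖c n * a n‖ ≤ ‖c n‖ * ‖a n‖ := norm_mul_le _ _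
    have h2 : ‖c n‖ ≤ ‖c‖ := lp.norm_apply_le_norm (by simp) c n
    calc ‖(c • a) n‖ = ‖c n * a n‖ := by simp [smul_eq_mul, lp.infty_coeFn_mul]
      _ ≤ ‖c n‖ * ‖a n‖ := h1
      _ ≤ ‖c‖ * ‖a n‖ := mul_le_mul_of_nonneg_right h2 (norm_nonneg _)

variable {A} in
theorem mem_nullSeqIdeal {a : BoundedSeq A} :
    a ∈ nullSeqIdeal A ↔ Tendsto (fun n => ‖a n‖) atTop (𝓝 0) := Iff.rfl

instance nullSeqIdeal_isTwoSided : (nullSeqIdeal A).IsTwoSided where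
  mul_mem_of_left {a} c ha := by
    rw [mem_nullSeqIdeal] at ha ⊢
    refine squeeze_zero (fun n => norm_nonneg _) (fun n => ?_)
      (by simpa using Tendsto.mul_const ‖c‖ ha)
    have h2 : ‖c n‖ ≤ ‖c‖ := lp.norm_apply_le_norm (by simp) c n
    calc ‖(a * c) n‖ = ‖a n * c n‖ := by simp [lp.infty_coeFn_mul]
      _ ≤ ‖a n‖ * ‖c n‖ := norm_mul_le _ _
      _ ≤ ‖a n‖ * ‖c‖ := mul_le_mul_of_nonneg_left h2 (norm_nonneg _)

/-- `A_∞ = ℓ^∞(ℕ, A) / c₀(ℕ, A)`. -/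
abbrev SeqAlgebra : Type _ := BoundedSeq A ⧸ nullSeqIdeal A

/-- The class in `A_∞` of a bounded sequence. -/
abbrev SeqAlgebra.mk : BoundedSeq A →+* SeqAlgebra A := Ideal.Quotient.mk (nullSeqIdeal A)

theorem star_mem_nullSeqIdeal {a : BoundedSeq A} (ha : a ∈ nullSeqIdeal A) :
    star a ∈ nullSeqIdeal A := by
  rw [mem_nullSeqIdeal] at ha ⊢
  simpa [lp.star_apply] using ha

/-- The involution of `A_∞`, induced by the pointwise involution of sequences. -/
instance SeqAlgebra.instStarRing : StarRing (SeqAlgebra A) where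
  star := Quotient.map' star fun a b h => by
    rw [Submodule.quotientRel_def] at h ⊢
    simpa using star_mem_nullSeqIdeal A h
  star_involutive := by
    rintro ⟨a⟩
    exact congrArg (SeqAlgebra.mk A) (star_star a)
  star_mul := by
    rintro ⟨a⟩ ⟨b⟩
    exact congrArg (SeqAlgebra.mk A) (star_mul a b)
  star_add := by
    rintro ⟨a⟩ ⟨b⟩
    exact congrArg (SeqAlgebra.mk A) (star_add a b)

/-- The constant sequence with value `a`. -/
def constSeq (a : A) : BoundedSeq A :=
  ⟨fun _ => a, memℓp_infty ⟨‖a‖, by rintro _ ⟨n, rfl⟩; exact le_rfl⟩⟩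

/-- The identification of `A` with the constant sequences in `A_∞`. -/
def SeqAlgebra.const (a : A) : SeqAlgebra A := SeqAlgebra.mk A (constSeq A a)

variable {A}

/-- The entrywise application of an automorphism to a bounded sequence. -/
def mapSeq (φ : A ≃⋆ₐ[ℂ] A) : BoundedSeq A →+* BoundedSeq A where
  toFun a := ⟨fun n => φ (a n), memℓp_infty ⟨‖a‖, by
    rintro _ ⟨n, rfl⟩
    exact (NonUnitalStarAlgHom.norm_apply_le (φ : A →⋆ₙₐ[ℂ] A) (a n)).trans
      (lp.norm_apply_le_norm (by simp) a n)⟩⟩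
  map_one' := by ext n; simp [lp.infty_coeFn_one]
  map_mul' a b := by ext n; simp [lp.infty_coeFn_mul]
  map_zero' := by ext n; simp
  map_add' a b := by ext n; exact map_add φ (a n) (b n)

/-- The automorphism `φ_∞` of `A_∞` induced by an automorphism `φ` of `A`, acting entrywise on
representing sequences (recorded as a ring homomorphism). -/
def SeqAlgebra.map (φ : A ≃⋆ₐ[ℂ] A) : SeqAlgebra A →+* SeqAlgebra A :=
  Ideal.quotientMap (nullSeqIdeal A) (mapSeq φ) fun a ha => by
    rw [Ideal.mem_comap]
    rw [mem_nullSeqIdeal] at ha ⊢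
    exact squeeze_zero (fun n => norm_nonneg _)
      (fun n => NonUnitalStarAlgHom.norm_apply_le (φ : A →⋆ₙₐ[ℂ] A) (a n)) ha

/-- An automorphism `β` of a unital C⋆-algebra `B` (so that `M(B) = B`) is *approximately
representable* if it is implemented on `B` by a unitary `v` of `B_∞` that is fixed by `β_∞`, that is,
by an asymptotically `β`-fixed sequence. -/
def IsApproxRepresentable (β : A ≃⋆ₐ[ℂ] A) : Prop :=
  ∃ v ∈ unitary (SeqAlgebra A), SeqAlgebra.map β v = v ∧
    ∀ b : A, SeqAlgebra.const A (β b) = v * SeqAlgebra.const A b * star v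

end SequenceAlgebra

/-! ### Circle actions and the Rokhlin property -/

/-- A (point-norm continuous) action of the circle group on a C⋆-algebra. -/
structure CircleAction (A : Type*) [CStarAlgebra A] where
  /-- the underlying group homomorphism `𝕋 → Aut(A)` -/
  toHom : Circle →* (A ≃⋆ₐ[ℂ] A)
  continuous_apply : ∀ a : A, Continuous fun ζ => toHom ζ a

/-- The Rokhlin property of a circle action. -/
def CircleAction.HasRokhlinProperty {A : Type*} [CStarAlgebra A] (α : CircleAction A) : Prop :=
  ∀ ε : ℝ, 0 < ε → ∀ F : Finset A, ∃ u ∈ unitary A,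
    (∀ ζ : Circle, ‖α.toHom ζ u - (ζ : ℂ) • u‖ < ε) ∧ ∀ a ∈ F, ‖u * a - a * u‖ < ε

/-! ### The crossed product of a unital C⋆-algebra by an automorphism -/

section CrossedProduct

variable {B : Type*} [CStarAlgebra B]

/-- The group `ℤ`, written multiplicatively, tagged with the automorphism whose powers it acts by. -/
def ZAct (_β : B ≃⋆ₐ[ℂ] B) : Type := Multiplicative ℤ

variable (β : B ≃⋆ₐ[ℂ] B)

instance ZAct.instCommGroup : CommGroup (ZAct β) := inferInstanceAs (CommGroup (Multiplicative ℤ))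

variable {β} in
/-- The integer underlying an element of `ZAct β`. -/
def ZAct.toInt (n : ZAct β) : ℤ := Multiplicative.toAdd (show Multiplicative ℤ from n)

variable {β} in
@[simp] theorem ZAct.toInt_one : ZAct.toInt (1 : ZAct β) = 0 := rfl

variable {β} in
@[simp] theorem ZAct.toInt_mul (m n : ZAct β) : (m * n).toInt = m.toInt + n.toInt := rfl

variable {β} in
@[simp] theorem ZAct.toInt_inv (n : ZAct β) : (n⁻¹).toInt = -n.toInt := rfl

/-- `n` acts on `B` by `β ^ n`. -/
instance ZAct.instMulSemiringAction : MulSemiringAction (ZAct β) B where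
  smul n b := (β ^ n.toInt) b
  one_smul b := by change (β ^ (0 : ℤ)) b = b; simp
  mul_smul m n b := by
    change (β ^ (m.toInt + n.toInt)) b = (β ^ m.toInt) ((β ^ n.toInt) b)
    rw [zpow_add]; rfl
  smul_zero n := map_zero (β ^ n.toInt)
  smul_add n := map_add (β ^ n.toInt)
  smul_one n := map_one (β ^ n.toInt)
  smul_mul n := map_mul (β ^ n.toInt)

theorem ZAct.smul_def (n : ZAct β) (b : B) : n • b = (β ^ n.toInt) b := rfl

instance ZAct.instSMulCommClass : SMulCommClass (ZAct β) ℂ B where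
  smul_comm n z b := by simp only [ZAct.smul_def, map_smul]

theorem ZAct.smul_star (n : ZAct β) (b : B) : n • star b = star (n • b) := by
  simp only [ZAct.smul_def, map_star]

theorem ZAct.norm_smul (n : ZAct β) (b : B) : ‖n • b‖ = ‖b‖ :=
  NonUnitalStarAlgHom.norm_map ((β ^ n.toInt : B ≃⋆ₐ[ℂ] B) : B →⋆ₙₐ[ℂ] B)
    (β ^ n.toInt : B ≃⋆ₐ[ℂ] B).injective b

/-- The convolution algebra `C_c(ℤ, B, β)`: finite sums `∑ bₙ uⁿ`, where `single n b` stands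
for `b uⁿ`, with `(a uᵐ) (b uⁿ) = a βᵐ(b) uᵐ⁺ⁿ`. -/
def ConvAlg : Type _ := SkewMonoidAlgebra B (ZAct β)

namespace ConvAlg

open SkewMonoidAlgebra

instance instRing : Ring (ConvAlg β) := inferInstanceAs (Ring (SkewMonoidAlgebra B (ZAct β)))

instance instAlgebra : Algebra ℂ (ConvAlg β) :=
  inferInstanceAs (Algebra ℂ (SkewMonoidAlgebra B (ZAct β)))

/-- The element `b uⁿ`. -/
def mono (n : ZAct β) (b : B) : ConvAlg β := SkewMonoidAlgebra.single n b

variable {β} in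
@[elab_as_elim]
theorem induct {p : ConvAlg β → Prop} (f : ConvAlg β) (zero : p 0)
    (mono : ∀ n b, p (mono β n b)) (add : ∀ f g, p f → p g → p (f + g)) : p f :=
  SkewMonoidAlgebra.induction_on f zero mono add

theorem mono_mul (m n : ZAct β) (a b : B) :
    mono β m a * mono β n b = mono β (m * n) (a * m • b) :=
  SkewMonoidAlgebra.single_mul_single

theorem mono_add (n : ZAct β) (a b : B) : mono β n (a + b) = mono β n a + mono β n b :=
  SkewMonoidAlgebra.single_add n a b

theorem mono_zero (n : ZAct β) : mono β n 0 = 0 := SkewMonoidAlgebra.single_zero n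

theorem smul_mono (z : ℂ) (n : ZAct β) (b : B) : z • mono β n b = mono β n (z • b) :=
  SkewMonoidAlgebra.smul_single z n b

theorem one_def : (1 : ConvAlg β) = mono β 1 1 := rfl

variable {β} in
/-- Additive extension of a family of additive maps on the coefficients. -/
def liftAdd {N : Type*} [AddCommMonoid N] (h : ZAct β → B →+ N) : ConvAlg β →+ N where
  toFun f := SkewMonoidAlgebra.sum f fun n b => h n b
  map_zero' := SkewMonoidAlgebra.sum_zero_index
  map_add' f g := SkewMonoidAlgebra.sum_add_index' (by simp) (by simp)

variable {β} in
theorem liftAdd_mono {N : Type*} [AddCommMonoid N] (h : ZAct β → B →+ N) (n : ZAct β) (b : B) :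
    liftAdd h (mono β n b) = h n b :=
  SkewMonoidAlgebra.sum_single_index (by simp)

/-- The involution of `C_c(ℤ, B, β)`, as an additive map: `(b uⁿ)* = β⁻ⁿ(b*) u⁻ⁿ`. -/
def starHom : ConvAlg β →+ ConvAlg β :=
  liftAdd fun n =>
    { toFun := fun b => mono β n⁻¹ (n⁻¹ • star b)
      map_zero' := by simp [mono_zero]
      map_add' := fun a b => by simp [mono_add] }

theorem starHom_mono (n : ZAct β) (b : B) :
    starHom β (mono β n b) = mono β n⁻¹ (n⁻¹ • star b) := liftAdd_mono _ n b

instance instStarRing : StarRing (ConvAlg β) where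
  star := starHom β
  star_involutive f := by
    induction f using induct with
    | zero => simp
    | mono n b =>
      rw [starHom_mono, starHom_mono, inv_inv, ← ZAct.smul_star, star_star, smul_inv_smul]
    | add f g hf hg => rw [map_add, map_add, hf, hg]
  star_mul f g := by
    change starHom β (f * g) = starHom β g * starHom β f
    induction f using induct with
    | zero => simp
    | add f₁ f₂ h₁ h₂ => rw [add_mul, map_add, h₁, h₂, map_add, mul_add]
    | mono m a =>
      induction g using induct with
      | zero => simp
      | add g₁ g₂ h₁ h₂ => rw [mul_add, map_add, h₁, h₂, map_add, add_mul]
      | mono n b =>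
        rw [mono_mul, starHom_mono, starHom_mono, starHom_mono, mono_mul, mul_inv_rev, star_mul,
          ← ZAct.smul_star, smul_mul', smul_smul, smul_smul, inv_mul_cancel_right]
  star_add f g := map_add (starHom β) f g

theorem star_mono (n : ZAct β) (b : B) :
    star (mono β n b) = mono β n⁻¹ (n⁻¹ • star b) := starHom_mono β n b

instance instStarModule : StarModule ℂ (ConvAlg β) where
  star_smul z f := by
    induction f using induct with
    | zero => simp
    | mono n b => rw [smul_mono, star_mono, star_mono, smul_mono, star_smul, smul_comm]
    | add f g hf hg => rw [smul_add, star_add, hf, hg, star_add, smul_add]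

variable {β} in
/-- The `ℓ¹`-norm `∑ ‖bₙ‖` of `∑ bₙ uⁿ`. -/
def l1Norm (f : ConvAlg β) : ℝ := SkewMonoidAlgebra.sum f fun _ b => ‖b‖

variable {β} in
/-- A seminorm `p` on `C_c(ℤ, B, β)` is a C⋆-seminorm (dominated by the `ℓ¹`-norm) if it is
submultiplicative and satisfies the C⋆-identity. These are exactly the seminorms
`f ↦ ‖∑ π(bₙ) Uⁿ‖` coming from covariant representations `(π, U)` of `(B, β)`. -/
structure IsCStarSeminorm (p : Seminorm ℂ (ConvAlg β)) : Prop where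
  mul_le : ∀ f g, p (f * g) ≤ p f * p g
  star_mul_self : ∀ f, p (star f * f) = p f * p f
  le_l1Norm : ∀ f, p f ≤ l1Norm f

/-- The C⋆-seminorms on `C_c(ℤ, B, β)`. -/
def CStarSeminorm : Type _ := {p : Seminorm ℂ (ConvAlg β) // IsCStarSeminorm p}

variable {β} in
theorem l1Norm_nonneg (f : ConvAlg β) : 0 ≤ l1Norm f := Finset.sum_nonneg fun _ _ => norm_nonneg _

instance : Nonempty (CStarSeminorm β) := ⟨⟨0, by simp, by simp, by simpa using l1Norm_nonneg⟩⟩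

variable {β} in
/-- The universal (maximal) C⋆-norm on `C_c(ℤ, B, β)`: the supremum of all C⋆-seminorms. -/
def maxNorm (f : ConvAlg β) : ℝ := ⨆ p : CStarSeminorm β, p.1 f

variable {β} in
theorem le_maxNorm (p : CStarSeminorm β) (f : ConvAlg β) : p.1 f ≤ maxNorm f :=
  le_ciSup (f := fun p : CStarSeminorm β => p.1 f)
    ⟨l1Norm f, by rintro _ ⟨q, rfl⟩; exact q.2.le_l1Norm f⟩ p

variable {β} in
theorem maxNorm_le {f : ConvAlg β} {r : ℝ} (h : ∀ p : CStarSeminorm β, p.1 f ≤ r) :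
    maxNorm f ≤ r := ciSup_le h

variable {β} in
theorem maxNorm_nonneg (f : ConvAlg β) : 0 ≤ maxNorm f :=
  (apply_nonneg (Classical.arbitrary (CStarSeminorm β)).1 f).trans (le_maxNorm _ f)

variable {β} in
theorem maxNorm_le_l1Norm (f : ConvAlg β) : maxNorm f ≤ l1Norm f :=
  maxNorm_le fun p => p.2.le_l1Norm f

/-- The universal norm, as a ring seminorm. -/
def maxRingSeminorm : RingSeminorm (ConvAlg β) where
  toFun := maxNorm
  map_zero' := le_antisymm (maxNorm_le fun p => by simp) (maxNorm_nonneg _)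
  add_le' f g := maxNorm_le fun p =>
    (map_add_le_add p.1 f g).trans (add_le_add (le_maxNorm p f) (le_maxNorm p g))
  neg' f := by simp [maxNorm]
  mul_le' f g := maxNorm_le fun p => (p.2.mul_le f g).trans
    (mul_le_mul (le_maxNorm p f) (le_maxNorm p g) (apply_nonneg _ _) (maxNorm_nonneg f))

instance instSeminormedRing : SeminormedRing (ConvAlg β) := (maxRingSeminorm β).toSeminormedRing

theorem norm_def (f : ConvAlg β) : ‖f‖ = maxNorm f := rfl

instance instNormedAlgebra : NormedAlgebra ℂ (ConvAlg β) where
  norm_smul_le z f := maxNorm_le fun p => by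
    rw [map_smul_eq_mul]
    exact mul_le_mul_of_nonneg_left (le_maxNorm p f) (norm_nonneg z)

theorem norm_mul_self_le_star_mul (f : ConvAlg β) : ‖f‖ * ‖f‖ ≤ ‖star f * f‖ := by
  rw [← sq, ← Real.le_sqrt (norm_nonneg _) (norm_nonneg _), norm_def, norm_def]
  refine maxNorm_le fun p => Real.le_sqrt_of_sq_le ?_
  rw [sq, ← p.2.star_mul_self]
  exact le_maxNorm p _

instance instNormedStarGroup : NormedStarGroup (ConvAlg β) where
  norm_star_le f := by
    have h := (norm_mul_self_le_star_mul β (star f)).trans (norm_mul_le _ _)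
    rw [star_star] at h
    by_contra! hlt
    have h0 : 0 < ‖star f‖ := (norm_nonneg f).trans_lt hlt
    exact absurd h (not_le.mpr (mul_lt_mul_of_pos_right hlt h0))

end ConvAlg

/-- The crossed product `B ⋊_β ℤ`: the completion of `C_c(ℤ, B, β)` in the universal C⋆-norm. -/
def CrossedProduct : Type _ := UniformSpace.Completion (ConvAlg β)

namespace CrossedProduct

open UniformSpace

instance instNormedRing : NormedRing (CrossedProduct β) :=
  inferInstanceAs (NormedRing (Completion (ConvAlg β)))

instance instCompleteSpace : CompleteSpace (CrossedProduct β) :=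
  inferInstanceAs (CompleteSpace (Completion (ConvAlg β)))

instance instAlgebra : Algebra ℂ (CrossedProduct β) :=
  inferInstanceAs (Algebra ℂ (Completion (ConvAlg β)))

variable {β} in
/-- The canonical map `C_c(ℤ, B, β) → B ⋊_β ℤ`. -/
def of (f : ConvAlg β) : CrossedProduct β := (f : Completion (ConvAlg β))

theorem of_add (f g : ConvAlg β) : of (f + g) = of f + of g := Completion.coe_add f g

theorem of_mul (f g : ConvAlg β) : of (f * g) = of f * of g := Completion.coe_mul f g

theorem of_smul (z : ℂ) (f : ConvAlg β) : of (z • f) = z • of f := Completion.coe_smul z f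

theorem norm_of (f : ConvAlg β) : ‖of f‖ = ‖f‖ := Completion.norm_coe f

variable {β} in
@[elab_as_elim]
theorem induct {p : CrossedProduct β → Prop} (x : CrossedProduct β) (closed : IsClosed {x | p x})
    (of : ∀ f, p (of f)) : p x :=
  Completion.induction_on x closed of

variable {β} in
@[elab_as_elim]
theorem induct₂ {p : CrossedProduct β → CrossedProduct β → Prop} (x y : CrossedProduct β)
    (closed : IsClosed {x : CrossedProduct β × CrossedProduct β | p x.1 x.2})
    (of : ∀ f g, p (of f) (of g)) : p x y :=
  Completion.induction_on₂ x y closed of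

instance instNormedAlgebra : NormedAlgebra ℂ (CrossedProduct β) where
  norm_smul_le z x := by
    induction x using induct with
    | closed =>
      exact isClosed_le (f := fun x : Completion (ConvAlg β) => ‖z • x‖)
        (continuous_norm.comp (continuous_const_smul z)) (continuous_const.mul continuous_norm)
    | of f => rw [← of_smul, norm_of, norm_of]; exact norm_smul_le z f

instance instStar : Star (CrossedProduct β) where
  star := Completion.map (star : ConvAlg β → ConvAlg β)

theorem star_of (f : ConvAlg β) : star (of f) = of (star f) :=
  Completion.map_coe (star_isometry (E := ConvAlg β)).uniformContinuous f

instance instContinuousStar : ContinuousStar (CrossedProduct β) where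
  continuous_star := Completion.continuous_map

instance instStarRing : StarRing (CrossedProduct β) where
  star_involutive x := by
    induction x using induct with
    | closed => exact isClosed_eq (continuous_star.comp continuous_star) continuous_id
    | of f => rw [star_of, star_of, star_star]
  star_mul x y := by
    induction x, y using induct₂ with
    | closed =>
      exact isClosed_eq (continuous_star.comp continuous_mul)
        ((continuous_star.comp continuous_snd).mul (continuous_star.comp continuous_fst))
    | of f g => rw [← of_mul, star_of, star_mul, of_mul, star_of, star_of]
  star_add x y := by
    induction x, y using induct₂ with
    | closed => exact isClosed_eq (by fun_prop) (by fun_prop)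
    | of f g => rw [← of_add, star_of, star_add, of_add, star_of, star_of]

instance instStarModule : StarModule ℂ (CrossedProduct β) where
  star_smul z x := by
    induction x using induct with
    | closed =>
      exact isClosed_eq (continuous_star.comp (continuous_const_smul z))
        ((continuous_const_smul (star z)).comp continuous_star)
    | of f => rw [← of_smul, star_of, star_smul, of_smul, star_of]

instance instCStarRing : CStarRing (CrossedProduct β) where
  norm_mul_self_le x := by
    induction x using induct with
    | closed => exact isClosed_le (by fun_prop) (by fun_prop)
    | of f =>
      rw [star_of, ← of_mul, norm_of, norm_of]
      exact ConvAlg.norm_mul_self_le_star_mul β f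

instance instCStarAlgebra : CStarAlgebra (CrossedProduct β) where

end CrossedProduct

/-! ### The dual action -/

namespace ConvAlg

/-- The map `∑ bₙ uⁿ ↦ ∑ ζⁿ bₙ uⁿ` on `C_c(ℤ, B, β)`, as an additive map. -/
def gaugeHom (ζ : Circle) : ConvAlg β →+ ConvAlg β :=
  liftAdd fun n =>
    { toFun := fun b => mono β n (((ζ ^ n.toInt : Circle) : ℂ) • b)
      map_zero' := by simp [mono_zero]
      map_add' := fun a b => by simp [mono_add] }

theorem gaugeHom_mono (ζ : Circle) (n : ZAct β) (b : B) :
    gaugeHom β ζ (mono β n b) = mono β n (((ζ ^ n.toInt : Circle) : ℂ) • b) := liftAdd_mono _ n b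

theorem gaugeHom_one_apply (f : ConvAlg β) : gaugeHom β 1 f = f := by
  induction f using induct with
  | zero => simp
  | mono n b => rw [gaugeHom_mono]; simp
  | add f g hf hg => rw [map_add, hf, hg]

theorem gaugeHom_gaugeHom (ζ ξ : Circle) (f : ConvAlg β) :
    gaugeHom β ζ (gaugeHom β ξ f) = gaugeHom β (ζ * ξ) f := by
  induction f using induct with
  | zero => simp
  | mono n b => rw [gaugeHom_mono, gaugeHom_mono, gaugeHom_mono, smul_smul, mul_zpow, Circle.coe_mul]
  | add f g hf hg => rw [map_add, map_add, map_add, hf, hg]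

theorem gaugeHom_mul (ζ : Circle) (f g : ConvAlg β) :
    gaugeHom β ζ (f * g) = gaugeHom β ζ f * gaugeHom β ζ g := by
  induction f using induct with
  | zero => simp
  | add f₁ f₂ h₁ h₂ => rw [add_mul, map_add, h₁, h₂, map_add, add_mul]
  | mono m a =>
    induction g using induct with
    | zero => simp
    | add g₁ g₂ h₁ h₂ => rw [mul_add, map_add, h₁, h₂, map_add, mul_add]
    | mono n b =>
      rw [mono_mul, gaugeHom_mono, gaugeHom_mono, gaugeHom_mono, mono_mul, smul_comm m,
        smul_mul_smul_comm, ZAct.toInt_mul, zpow_add, Circle.coe_mul]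

theorem gaugeHom_star (ζ : Circle) (f : ConvAlg β) :
    gaugeHom β ζ (star f) = star (gaugeHom β ζ f) := by
  induction f using induct with
  | zero => simp
  | mono n b =>
    rw [star_mono, gaugeHom_mono, gaugeHom_mono, star_mono, star_smul, smul_comm n⁻¹,
      ZAct.toInt_inv, zpow_neg, Circle.coe_inv_eq_conj]
    rfl
  | add f g hf hg => rw [star_add, map_add, hf, hg, map_add, star_add]

theorem gaugeHom_smul (ζ : Circle) (z : ℂ) (f : ConvAlg β) :
    gaugeHom β ζ (z • f) = z • gaugeHom β ζ f := by
  induction f using induct with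
  | zero => simp
  | mono n b => rw [smul_mono, gaugeHom_mono, gaugeHom_mono, smul_mono, smul_comm]
  | add f g hf hg => rw [smul_add, map_add, hf, hg, map_add, smul_add]

theorem l1Norm_gaugeHom_le (ζ : Circle) (f : ConvAlg β) : l1Norm (gaugeHom β ζ f) ≤ l1Norm f := by
  have hcoeff : ∀ n, SkewMonoidAlgebra.coeff (gaugeHom β ζ f) n =
      ((ζ ^ n.toInt : Circle) : ℂ) • SkewMonoidAlgebra.coeff f n := fun n => by
    classical
    induction f using induct with
    | zero =>
      rw [map_zero]
      exact (smul_zero _).symm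
    | mono m b =>
      rw [gaugeHom_mono]
      simp only [mono, SkewMonoidAlgebra.coeff_single, Finsupp.single_apply]
      split_ifs with h
      · rw [h]
      · rw [smul_zero]
    | add f g hf hg =>
      rw [map_add]
      have hadd : ∀ f g : ConvAlg β, SkewMonoidAlgebra.coeff (f + g) n =
          SkewMonoidAlgebra.coeff f n + SkewMonoidAlgebra.coeff g n := fun f g =>
        DFunLike.congr_fun (SkewMonoidAlgebra.coeff_add f g) n
      rw [hadd, hadd, hf, hg, smul_add]
  have hsub : (SkewMonoidAlgebra.coeff (gaugeHom β ζ f)).support ⊆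
      (SkewMonoidAlgebra.coeff f).support := fun n hn => by
    rw [Finsupp.mem_support_iff] at hn ⊢
    intro h0
    exact hn (by rw [hcoeff, h0, smul_zero])
  calc l1Norm (gaugeHom β ζ f)
      ≤ ∑ n ∈ (SkewMonoidAlgebra.coeff f).support,
          ‖SkewMonoidAlgebra.coeff (gaugeHom β ζ f) n‖ :=
        Finset.sum_le_sum_of_subset_of_nonneg hsub fun _ _ _ => norm_nonneg _
    _ = l1Norm f := Finset.sum_congr rfl fun n _ => by
        rw [hcoeff, norm_smul, Circle.norm_coe, one_mul]

theorem norm_gaugeHom_le (ζ : Circle) (f : ConvAlg β) : ‖gaugeHom β ζ f‖ ≤ ‖f‖ :=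
  maxNorm_le fun p => by
    let L : ConvAlg β →ₗ[ℂ] ConvAlg β :=
      { toFun := gaugeHom β ζ, map_add' := map_add _, map_smul' := gaugeHom_smul β ζ }
    refine le_maxNorm (⟨p.1.comp L, ?_, ?_, ?_⟩ : CStarSeminorm β) f
    · intro f g
      change p.1 (gaugeHom β ζ (f * g)) ≤ p.1 (gaugeHom β ζ f) * p.1 (gaugeHom β ζ g)
      rw [gaugeHom_mul]
      exact p.2.mul_le _ _
    · intro f
      change p.1 (gaugeHom β ζ (star f * f)) = p.1 (gaugeHom β ζ f) * p.1 (gaugeHom β ζ f)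
      rw [gaugeHom_mul, gaugeHom_star]
      exact p.2.star_mul_self _
    · exact fun f => (p.2.le_l1Norm _).trans (l1Norm_gaugeHom_le β ζ f)

theorem norm_mono_le (n : ZAct β) (b : B) : ‖mono β n b‖ ≤ ‖b‖ :=
  (maxNorm_le_l1Norm _).trans_eq (SkewMonoidAlgebra.sum_single_index (by simp))

theorem continuous_mono (n : ZAct β) : Continuous (mono β n) :=
  AddMonoidHomClass.continuous_of_bound
    ({ toFun := mono β n, map_zero' := mono_zero β n, map_add' := mono_add β n } :
      B →+ ConvAlg β) 1 fun b => by simpa using norm_mono_le β n b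

theorem continuous_gaugeHom (ζ : Circle) : Continuous (gaugeHom β ζ) :=
  AddMonoidHomClass.continuous_of_bound (gaugeHom β ζ) 1 fun f => by
    simpa using norm_gaugeHom_le β ζ f

theorem continuous_gaugeHom_apply (f : ConvAlg β) : Continuous fun ζ => gaugeHom β ζ f := by
  induction f using induct with
  | zero => simpa using continuous_const
  | mono n b =>
    simp only [gaugeHom_mono]
    refine (continuous_mono β n).comp (Continuous.smul ?_ continuous_const)
    exact continuous_subtype_val.comp (continuous_zpow (G := Circle) n.toInt)
  | add f g hf hg => simp only [map_add]; exact hf.add hg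

end ConvAlg

namespace CrossedProduct

open UniformSpace

/-- The extension of `∑ bₙ uⁿ ↦ ∑ ζⁿ bₙ uⁿ` to `B ⋊_β ℤ`. -/
def gauge (ζ : Circle) : CrossedProduct β → CrossedProduct β :=
  Completion.map (ConvAlg.gaugeHom β ζ)

theorem gauge_of (ζ : Circle) (f : ConvAlg β) :
    gauge β ζ (of f) = of (ConvAlg.gaugeHom β ζ f) :=
  Completion.map_coe
    (uniformContinuous_addMonoidHom_of_continuous (ConvAlg.continuous_gaugeHom β ζ)) f

theorem continuous_gauge (ζ : Circle) : Continuous (gauge β ζ) := Completion.continuous_map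

theorem gauge_one_apply (x : CrossedProduct β) : gauge β 1 x = x := by
  induction x using induct with
  | closed => exact isClosed_eq (continuous_gauge β 1) continuous_id
  | of f => rw [gauge_of, ConvAlg.gaugeHom_one_apply]

theorem gauge_gauge (ζ ξ : Circle) (x : CrossedProduct β) :
    gauge β ζ (gauge β ξ x) = gauge β (ζ * ξ) x := by
  induction x using induct with
  | closed =>
    exact isClosed_eq ((continuous_gauge β ζ).comp (continuous_gauge β ξ)) (continuous_gauge β _)
  | of f => rw [gauge_of, gauge_of, gauge_of, ConvAlg.gaugeHom_gaugeHom]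

/-- The automorphism `β̂_ζ` of `B ⋊_β ℤ`, with `β̂_ζ(b uⁿ) = ζⁿ b uⁿ`. -/
def gaugeAut (ζ : Circle) : CrossedProduct β ≃⋆ₐ[ℂ] CrossedProduct β where
  toFun := gauge β ζ
  invFun := gauge β ζ⁻¹
  left_inv x := by rw [gauge_gauge, inv_mul_cancel, gauge_one_apply]
  right_inv x := by rw [gauge_gauge, mul_inv_cancel, gauge_one_apply]
  map_mul' x y := by
    have h := continuous_gauge β ζ
    induction x, y using induct₂ with
    | closed =>
      exact isClosed_eq (h.comp continuous_mul)
        ((h.comp continuous_fst).mul (h.comp continuous_snd))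
    | of f g => rw [← of_mul, gauge_of, ConvAlg.gaugeHom_mul, of_mul, gauge_of, gauge_of]
  map_add' x y := by
    have h := continuous_gauge β ζ
    induction x, y using induct₂ with
    | closed => exact isClosed_eq (by fun_prop) (by fun_prop)
    | of f g => rw [← of_add, gauge_of, map_add, of_add, gauge_of, gauge_of]
  map_star' x := by
    have h := continuous_gauge β ζ
    induction x using induct with
    | closed => exact isClosed_eq (by fun_prop) (by fun_prop)
    | of f => rw [star_of, gauge_of, ConvAlg.gaugeHom_star, gauge_of, star_of]
  map_smul' z x := by
    have h := continuous_gauge β ζ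
    induction x using induct with
    | closed =>
      exact isClosed_eq (h.comp (continuous_const_smul z)) ((continuous_const_smul z).comp h)
    | of f => rw [← of_smul, gauge_of, ConvAlg.gaugeHom_smul, gauge_of, of_smul]

theorem continuous_gauge_apply (x : CrossedProduct β) : Continuous fun ζ => gauge β ζ x := by
  have hn : ∀ (ζ : Circle) (y : CrossedProduct β), ‖gauge β ζ y‖ = ‖y‖ := fun ζ y =>
    NonUnitalStarAlgHom.norm_map (gaugeAut β ζ : CrossedProduct β →⋆ₙₐ[ℂ] CrossedProduct β)
      (gaugeAut β ζ).injective y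
  refine continuous_of_uniform_approx_of_continuous fun U hU => ?_
  obtain ⟨ε, hε, hU⟩ := Metric.mem_uniformity_dist.mp hU
  obtain ⟨f, hf⟩ : ∃ f : ConvAlg β, dist x (of f) < ε :=
    (Completion.denseRange_coe (α := ConvAlg β)).exists_dist_lt x hε
  refine ⟨fun ζ => gauge β ζ (of f), ?_, fun ζ => hU ?_⟩
  · simp only [gauge_of]
    exact (Completion.continuous_coe (ConvAlg β)).comp (ConvAlg.continuous_gaugeHom_apply β f)
  · have h : gauge β ζ x - gauge β ζ (of f) = gauge β ζ (x - of f) :=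
      (map_sub (gaugeAut β ζ) x (of f)).symm
    rw [dist_eq_norm, h, hn, ← dist_eq_norm]
    exact hf

end CrossedProduct

/-- The dual action `β̂` of the circle on `B ⋊_β ℤ`, with `β̂_ζ(b uⁿ) = ζⁿ b uⁿ`. -/
def dualAction : CircleAction (CrossedProduct β) where
  toHom :=
    { toFun := CrossedProduct.gaugeAut β
      map_one' := StarAlgEquiv.ext (CrossedProduct.gauge_one_apply β)
      map_mul' := fun ζ ξ =>
        StarAlgEquiv.ext fun x => (CrossedProduct.gauge_gauge β ζ ξ x).symm }
  continuous_apply := CrossedProduct.continuous_gauge_apply β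

end CrossedProduct

/-! Both directions rest on the correspondence v ↔ w = v⋆u between asymptotic implementers of β in B
and asymptotically central unitaries w of the crossed product with β̂_ζ(w) ≈ ζw.

Given v, lift it to unitaries vₙ of B (`exists_unitary_seq`, by polar decomposition) and put wₙ =
vₙ⋆u. Then β̂_ζ(wₙ) = ζwₙ exactly, and the commutator of wₙ with buᵐ is small because vₙ implements
β and is almost fixed by βᵐ (`norm_commutator_mono_le`).

Conversely, given Rokhlin unitaries wₙ, the element xₙ = wₙu⋆ is almost invariant under β̂.
Averaging over roots of unity puts it close to some cₙ in B (`exists_norm_sub_base_lt`). Almost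
commutation of wₙ with B gives xₙ⋆bxₙ ≈ ubu⋆ = β(b), and almost commutation with u gives β(cₙ) ≈ cₙ,
so the sequence cₙ⋆ represents the required unitary.

To read the last estimates in B, the map B → B ⋊ ℤ must be isometric (`ConvAlg.norm_mono_one`). The
universal norm is a supremum of C⋆-seminorms, so one seminorm that is at least the norm on B
suffices; it comes from right multiplication on the Hilbert B-module C_c(ℤ, B, β). -/

/-! ### The canonical Hilbert module of the crossed product -/

namespace ConvAlg

variable {B : Type*} [CStarAlgebra B] (β : B ≃⋆ₐ[ℂ] B)

/-- The coefficient `bₙ` of `∑ bₙ uⁿ`. -/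
def coeffLin (n : ZAct β) : ConvAlg β →ₗ[ℂ] B where
  toFun f := SkewMonoidAlgebra.coeff f n
  map_add' f g := DFunLike.congr_fun (SkewMonoidAlgebra.coeff_add f g) n
  map_smul' _ _ := rfl

theorem coeffLin_mono_same (n : ZAct β) (b : B) : coeffLin β n (mono β n b) = b := by
  classical
  change SkewMonoidAlgebra.coeff (SkewMonoidAlgebra.single n b) n = b
  simp [SkewMonoidAlgebra.coeff_single]

theorem coeffLin_mono_of_ne {m n : ZAct β} (h : m ≠ n) (b : B) :
    coeffLin β n (mono β m b) = 0 := by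
  classical
  change SkewMonoidAlgebra.coeff (SkewMonoidAlgebra.single m b) n = 0
  simp [SkewMonoidAlgebra.coeff_single, h]

theorem coeffLin_mul_mono (m n : ZAct β) (f : ConvAlg β) (b : B) :
    coeffLin β n (f * mono β m b) = coeffLin β (n * m⁻¹) f * (n * m⁻¹) • b :=
  SkewMonoidAlgebra.coeff_mul_single f b m n

theorem coeffLin_mono_one_mul (n : ZAct β) (f : ConvAlg β) (b : B) :
    coeffLin β n (mono β 1 b * f) = b * coeffLin β n f :=
  SkewMonoidAlgebra.coeff_single_one_mul f b n

theorem coeffLin_star (f : ConvAlg β) : coeffLin β 1 (star f) = star (coeffLin β 1 f) := by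
  induction f using induct with
  | zero => simp
  | mono n b =>
    rw [star_mono]
    rcases eq_or_ne n 1 with rfl | hn
    · rw [inv_one, one_smul, coeffLin_mono_same, coeffLin_mono_same]
    · rw [coeffLin_mono_of_ne β hn, coeffLin_mono_of_ne β (by simpa using hn), star_zero]
  | add f g hf hg => rw [star_add, map_add, hf, hg, map_add, star_add]

/-- The twists cancel: (buⁿ)⋆ = β⁻ⁿ(b⋆)u⁻ⁿ, and moving its coefficient past uⁿ restores b⋆.
Positivity and definiteness of the inner product below follow from this untwisted sum. -/
theorem coeffLin_mul_star (f g : ConvAlg β) :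
    coeffLin β 1 (f * star g) =
      ∑ n ∈ (SkewMonoidAlgebra.coeff g).support, coeffLin β n f * star (coeffLin β n g) := by
  change _ = SkewMonoidAlgebra.sum g fun n b => coeffLin β n f * star b
  induction g using induct with
  | zero =>
    rw [star_zero, mul_zero, map_zero]
    exact SkewMonoidAlgebra.sum_zero_index.symm
  | mono n b =>
    rw [star_mono, coeffLin_mul_mono, inv_inv, one_mul, smul_inv_smul]
    exact (SkewMonoidAlgebra.sum_single_index
      (h := fun n b => coeffLin β n f * star b) (by simp)).symm
  | add g₁ g₂ h₁ h₂ =>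
    rw [star_add, mul_add, map_add, h₁, h₂]
    exact (SkewMonoidAlgebra.sum_add_index'
      (h := fun n b => coeffLin β n f * star b) (fun n => by rw [star_zero, mul_zero])
      fun n a b => by rw [star_add, mul_add]).symm

end ConvAlg

/-- `C_c(ℤ, B, β)` with the `B`-valued inner product `⟪x, y⟫ = ∑ yₙ xₙ*`. -/
def CrossedModule {B : Type*} [CStarAlgebra B] (β : B ≃⋆ₐ[ℂ] B) : Type _ := ConvAlg β

namespace CrossedModule

variable {B : Type*} [CStarAlgebra B] (β : B ≃⋆ₐ[ℂ] B)

attribute [local instance] CStarAlgebra.spectralOrder CStarAlgebra.spectralOrderedRing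

instance instAddCommGroup : AddCommGroup (CrossedModule β) :=
  inferInstanceAs (AddCommGroup (ConvAlg β))

instance instModule : Module ℂ (CrossedModule β) := inferInstanceAs (Module ℂ (ConvAlg β))

/-- The element of the Hilbert module given by an element of `C_c(ℤ, B, β)`. -/
def ofConv : ConvAlg β ≃ₗ[ℂ] CrossedModule β := LinearEquiv.refl ℂ (ConvAlg β)

instance instSMul : SMul B (CrossedModule β) where
  smul b x := ofConv β (ConvAlg.mono β 1 b * (ofConv β).symm x)

instance instInner : Inner B (CrossedModule β) where
  inner x y := ConvAlg.coeffLin β 1 ((ofConv β).symm y * star ((ofConv β).symm x))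

theorem inner_def (x y : CrossedModule β) :
    inner B x y = ConvAlg.coeffLin β 1 ((ofConv β).symm y * star ((ofConv β).symm x)) := rfl

theorem smul_def (b : B) (x : CrossedModule β) :
    b • x = ofConv β (ConvAlg.mono β 1 b * (ofConv β).symm x) := rfl

/-- The type synonym keeps this Hilbert module norm apart from the universal norm on `ConvAlg β`. -/
instance instNorm : Norm (CrossedModule β) := CStarModule.norm B

theorem coeffLin_mul_star_self_nonneg (x : ConvAlg β) :
    0 ≤ ConvAlg.coeffLin β 1 (x * star x) := by
  rw [ConvAlg.coeffLin_mul_star]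
  exact Finset.sum_nonneg fun n _ => mul_star_self_nonneg _

theorem coeffLin_mul_star_self_eq_zero {x : ConvAlg β} :
    ConvAlg.coeffLin β 1 (x * star x) = 0 ↔ x = 0 := by
  refine ⟨fun h => ?_, fun h => by rw [h, zero_mul, map_zero]⟩
  rw [ConvAlg.coeffLin_mul_star, Finset.sum_eq_zero_iff_of_nonneg
    fun n _ => mul_star_self_nonneg _] at h
  refine SkewMonoidAlgebra.coeff_injective (Finsupp.ext fun n => ?_)
  by_contra hn
  have := h n (Finsupp.mem_support_iff.mpr hn)
  rw [CStarRing.mul_star_self_eq_zero_iff] at this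
  exact hn this

instance instCStarModule : CStarModule B (CrossedModule β) where
  inner_add_right {x y z} := by simp only [inner_def, map_add, add_mul]
  inner_self_nonneg {x} := coeffLin_mul_star_self_nonneg β _
  inner_self {x} := by
    rw [inner_def, coeffLin_mul_star_self_eq_zero, LinearEquiv.map_eq_zero_iff]
  inner_op_smul_right {a x y} := by
    rw [inner_def, smul_def, LinearEquiv.symm_apply_apply, mul_assoc,
      ConvAlg.coeffLin_mono_one_mul, inner_def]
  inner_smul_right_complex {z x y} := by simp only [inner_def, map_smul, smul_mul_assoc]
  star_inner x y := by rw [inner_def, inner_def, ← ConvAlg.coeffLin_star, star_mul, star_star]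
  norm_eq_sqrt_norm_inner_self _ := rfl

instance instNormedAddCommGroup : NormedAddCommGroup (CrossedModule β) :=
  CStarModule.normedAddCommGroup B

instance instNormedSpace : NormedSpace ℂ (CrossedModule β) :=
  .ofCore (CStarModule.normedSpaceCore B)

/-! ### Norm estimates for right multiplication -/

theorem norm_sq (x : ConvAlg β) : ‖ofConv β x‖ ^ 2 =
    ‖ConvAlg.coeffLin β 1 (x * star x)‖ := CStarModule.norm_sq_eq B

theorem norm_coeffLin_mul_star_le (x y : ConvAlg β) : ‖ConvAlg.coeffLin β 1 (y * star x)‖ ≤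
    ‖ofConv β x‖ * ‖ofConv β y‖ :=
  CStarModule.norm_inner_le (A := B) (CrossedModule β)

/-- Since (buⁿ)(buⁿ)⋆ = bb⋆, the inner square of xbuⁿ is ∑ xₘ βᵐ(bb⋆) xₘ⋆, and βᵐ(bb⋆) ≤ ‖b‖² bounds
it term by term. -/
theorem norm_mul_mono_le (x : ConvAlg β) (n : ZAct β) (b : B) :
    ‖ofConv β (x * ConvAlg.mono β n b)‖ ≤
      ‖b‖ * ‖ofConv β x‖ := by
  refine abs_le_of_sq_le_sq' ?_ (by positivity) |>.2
  rw [norm_sq, mul_pow, norm_sq, star_mul, ConvAlg.star_mono, mul_assoc, ← mul_assoc _ _ (star x),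
    ConvAlg.mono_mul, mul_inv_cancel, smul_inv_smul, ← mul_assoc, ConvAlg.coeffLin_mul_star,
    ConvAlg.coeffLin_mul_star]
  have h : ∑ m ∈ (SkewMonoidAlgebra.coeff x).support,
      ConvAlg.coeffLin β m (x * ConvAlg.mono β 1 (b * star b)) * star (ConvAlg.coeffLin β m x) ≤
      ‖b‖ ^ 2 • ∑ m ∈ (SkewMonoidAlgebra.coeff x).support,
        ConvAlg.coeffLin β m x * star (ConvAlg.coeffLin β m x) := by
    rw [Finset.smul_sum]
    refine Finset.sum_le_sum fun m _ => ?_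
    rw [ConvAlg.coeffLin_mul_mono, inv_one, mul_one]
    have hs : IsSelfAdjoint (m • (b * star b)) := by
      rw [IsSelfAdjoint, ← ZAct.smul_star, star_mul, star_star]
    refine (CStarAlgebra.star_right_conjugate_le_norm_smul (hb := hs)).trans_eq ?_
    rw [ZAct.norm_smul, CStarRing.norm_self_mul_star, sq]
  refine (CStarAlgebra.norm_le_norm_of_nonneg_of_le (Finset.sum_nonneg fun m _ => ?_) h).trans_eq ?_
  · rw [ConvAlg.coeffLin_mul_mono, inv_one, mul_one, smul_mul', ZAct.smul_star, ← mul_assoc,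
      mul_assoc, ← star_mul]
    exact mul_star_self_nonneg _
  · rw [norm_smul, norm_pow, norm_norm]

theorem norm_mul_le (x f : ConvAlg β) : ‖ofConv β (x * f)‖ ≤
    ConvAlg.l1Norm f * ‖ofConv β x‖ := by
  have hf : f = ∑ n ∈ (SkewMonoidAlgebra.coeff f).support,
      ConvAlg.mono β n (SkewMonoidAlgebra.coeff f n) := (SkewMonoidAlgebra.sum_single f).symm
  conv_lhs => rw [hf, Finset.mul_sum, map_sum]
  refine (norm_sum_le _ _).trans ?_
  change _ ≤ (∑ n ∈ (SkewMonoidAlgebra.coeff f).support, ‖SkewMonoidAlgebra.coeff f n‖) * _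
  rw [Finset.sum_mul]
  exact Finset.sum_le_sum fun n _ => norm_mul_mono_le β x n _

/-- Right multiplication by an element of `C_c(ℤ, B, β)`, as a bounded operator. -/
def rightMulCLM (f : ConvAlg β) : CrossedModule β →L[ℂ] CrossedModule β :=
  LinearMap.mkContinuous
    ((ofConv β).toLinearMap ∘ₗ LinearMap.mulRight ℂ f ∘ₗ (ofConv β).symm.toLinearMap)
    (ConvAlg.l1Norm f) fun x => norm_mul_le β ((ofConv β).symm x) f

theorem rightMulCLM_apply (f : ConvAlg β) (x : CrossedModule β) :
    rightMulCLM β f x = ofConv β ((ofConv β).symm x * f) := rfl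

/-- The right regular representation of `C_c(ℤ, B, β)`. -/
def rightMul : ConvAlg β →ₗ[ℂ] CrossedModule β →L[ℂ] CrossedModule β where
  toFun := rightMulCLM β
  map_add' f g := by ext x; simp [rightMulCLM_apply, mul_add]
  map_smul' z f := by ext x; simp [rightMulCLM_apply]

theorem rightMul_apply (f : ConvAlg β) (x : CrossedModule β) :
    rightMul β f x = ofConv β ((ofConv β).symm x * f) := rfl

theorem norm_rightMul_mul_le (f g : ConvAlg β) :
    ‖rightMul β (f * g)‖ ≤ ‖rightMul β f‖ * ‖rightMul β g‖ := by
  -- Right multiplication reverses products, which is harmless because the bound is symmetric in the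
  -- two norms.
  have h : rightMul β (f * g) = (rightMul β g).comp (rightMul β f) := by
    ext x
    simp [rightMul_apply, mul_assoc]
  rw [h, mul_comm]
  exact ContinuousLinearMap.opNorm_comp_le _ _

/-- The inner square of xf is also the inner product of x with xff⋆, so Cauchy–Schwarz gives half of
the C⋆-identity without constructing adjoints or completing the module. -/
theorem sq_norm_rightMul_le (f : ConvAlg β) :
    ‖rightMul β f‖ ^ 2 ≤ ‖rightMul β (f * star f)‖ := by
  rw [← Real.le_sqrt (norm_nonneg _) (norm_nonneg _)]
  refine ContinuousLinearMap.opNorm_le_bound _ (Real.sqrt_nonneg _) fun x => ?_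
  rw [← Real.sqrt_sq (norm_nonneg x), ← Real.sqrt_mul (norm_nonneg _)]
  refine Real.le_sqrt_of_sq_le ?_
  obtain ⟨x, rfl⟩ := (ofConv β).surjective x
  rw [rightMul_apply, LinearEquiv.symm_apply_apply, norm_sq, star_mul, mul_assoc, ← mul_assoc f, ← mul_assoc]
  refine (norm_coeffLin_mul_star_le β _ _).trans ?_
  rw [sq, mul_left_comm]
  exact mul_le_mul_of_nonneg_left ((rightMul β (f * star f)).le_opNorm x) (norm_nonneg _)

theorem norm_rightMul_star_le (f : ConvAlg β) : ‖rightMul β f‖ ≤ ‖rightMul β (star f)‖ := by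
  have h := (sq_norm_rightMul_le β f).trans (norm_rightMul_mul_le β f (star f))
  rw [sq] at h
  by_contra! hlt
  exact absurd h (not_le.mpr (mul_lt_mul_of_pos_left hlt ((norm_nonneg _).trans_lt hlt)))

theorem norm_rightMul_star (f : ConvAlg β) : ‖rightMul β (star f)‖ = ‖rightMul β f‖ :=
  le_antisymm (by simpa using norm_rightMul_star_le β (star f)) (norm_rightMul_star_le β f)

theorem isCStarSeminorm_rightMul :
    ConvAlg.IsCStarSeminorm ((normSeminorm ℂ _).comp (rightMul β)) where
  mul_le f g := norm_rightMul_mul_le β f g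
  star_mul_self f := by
    change ‖rightMul β (star f * f)‖ = ‖rightMul β f‖ * ‖rightMul β f‖
    refine le_antisymm ?_ ?_
    · simpa [norm_rightMul_star] using norm_rightMul_mul_le β (star f) f
    · simpa [norm_rightMul_star, sq] using sq_norm_rightMul_le β (star f)
  le_l1Norm f := ContinuousLinearMap.opNorm_le_bound _ (ConvAlg.l1Norm_nonneg f) fun x =>
    norm_mul_le β ((ofConv β).symm x) f

/-- Test the operator on the vector 1: it is sent to b, and the module norm restricted to B is the
norm of B. -/
theorem le_norm_rightMul_mono (b : B) : ‖b‖ ≤ ‖rightMul β (ConvAlg.mono β 1 b)‖ := by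
  have hn : ∀ c : B, ‖ofConv β (ConvAlg.mono β 1 c)‖ = ‖c‖ := fun c => by
    refine (pow_left_inj₀ (norm_nonneg _) (norm_nonneg _) two_ne_zero).mp ?_
    rw [norm_sq, ConvAlg.star_mono, ConvAlg.mono_mul, mul_inv_cancel, inv_one, one_smul, one_smul,
      ConvAlg.coeffLin_mono_same, CStarRing.norm_self_mul_star, sq]
  nontriviality B
  have h := (rightMul β (ConvAlg.mono β 1 b)).le_opNorm (ofConv β (ConvAlg.mono β 1 1))
  rwa [hn, norm_one, mul_one, rightMul_apply, LinearEquiv.symm_apply_apply, ConvAlg.mono_mul,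
    one_mul, one_smul, one_mul, hn] at h

end CrossedModule

/-- The ℓ¹-norm bounds the universal norm from above, the right regular representation from below.
-/
theorem ConvAlg.norm_mono_one {B : Type*} [CStarAlgebra B] (β : B ≃⋆ₐ[ℂ] B) (b : B) :
    ‖ConvAlg.mono β 1 b‖ = ‖b‖ :=
  le_antisymm (ConvAlg.norm_mono_le β 1 b) <| (CrossedModule.le_norm_rightMul_mono β b).trans
    (ConvAlg.le_maxNorm ⟨_, CrossedModule.isCStarSeminorm_rightMul β⟩ _)

/-! ### Approximate unitaries -/

section Unitary

variable {A : Type*} [CStarAlgebra A]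

attribute [local instance] CStarAlgebra.spectralOrder CStarAlgebra.spectralOrderedRing in
-- On the spectrum, t − 1 = (√t − 1)(√t + 1) with √t + 1 ≥ 1.
theorem norm_sqrt_sub_one_le {a : A} (ha : 0 ≤ a) : ‖CFC.sqrt a - 1‖ ≤ ‖a - 1‖ := by
  have hs : IsSelfAdjoint a := .of_nonneg ha
  have h1 : CFC.sqrt a - 1 = cfc (fun t : ℝ => √t - 1) a := by
    rw [CFC.sqrt_eq_real_sqrt a, cfcₙ_eq_cfc, cfc_sub _ _ a, cfc_const_one ℝ a]
  have h2 : a - 1 = cfc (fun t : ℝ => t - 1) a := by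
    rw [cfc_sub _ _ a, cfc_id' ℝ a, cfc_const_one ℝ a]
  rw [h1]
  refine norm_cfc_le (norm_nonneg _) fun t ht => ?_
  have ht0 : 0 ≤ t := spectrum_nonneg_of_nonneg ha ht
  have h3 := norm_apply_le_norm_cfc (fun t : ℝ => t - 1) a ht
  rw [← h2] at h3
  refine le_trans ?_ h3
  have h4 : t - 1 = (√t - 1) * (√t + 1) := by nlinarith [Real.sq_sqrt ht0]
  change ‖√t - 1‖ ≤ ‖t - 1‖
  rw [h4, norm_mul]
  refine le_mul_of_one_le_right (norm_nonneg _) ?_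
  rw [Real.norm_of_nonneg (by positivity)]
  linarith [Real.sqrt_nonneg t]

attribute [local instance] CStarAlgebra.spectralOrder CStarAlgebra.spectralOrderedRing in
/-- The unitary in the polar decomposition of an invertible element. -/
theorem exists_unitary_norm_sub_le {v : A} (hv : IsUnit v) :
    ∃ w ∈ unitary A, ‖v - w‖ ≤ ‖star v * v - 1‖ := by
  nontriviality A
  have ha : 0 ≤ star v * v := star_mul_self_nonneg v
  obtain ⟨s, hs⟩ : IsUnit (CFC.sqrt (star v * v)) := (CFC.isUnit_sqrt_iff _).mpr (hv.star.mul hv)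
  have hsa : star (s : A) = s := by
    rw [hs]; exact IsSelfAdjoint.of_nonneg (CFC.sqrt_nonneg _)
  have hss : (s : A) * s = star v * v := by rw [hs, CFC.sqrt_mul_sqrt_self _]
  have hsi : star (↑s⁻¹ : A) = ↑s⁻¹ := by
    rw [← Units.coe_star_inv, Units.inv_eq_of_mul_eq_one_right]
    simp [hsa]
  have hl : star (v * ↑s⁻¹) * (v * ↑s⁻¹) = 1 := by
    rw [star_mul, hsi, mul_assoc, ← mul_assoc (star v), ← hss]
    simp [mul_assoc]
  have hw : v * ↑s⁻¹ ∈ unitary A := by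
    refine Unitary.mem_iff.mpr ⟨hl, ?_⟩
    obtain ⟨u, hu⟩ := hv.mul s⁻¹.isUnit
    rw [← hu] at hl ⊢
    rw [Units.eq_inv_of_mul_eq_one_right hl, Units.mul_inv]
  refine ⟨_, hw, ?_⟩
  -- With |v| = s and w = v|v|⁻¹, the error v − w equals w(|v| − 1), and the unitary w does not
  -- affect its norm.
  have h : v - v * ↑s⁻¹ = v * ↑s⁻¹ * (s - 1) := by simp [mul_sub, mul_assoc]
  rw [h, CStarRing.norm_mem_unitary_mul _ hw, hs]
  exact norm_sqrt_sub_one_le ha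

/-- By the Neumann series v⋆v and vv⋆ are invertible, which gives v a left and a right inverse. -/
theorem isUnit_of_norm_sub_one_lt {v : A} (h₁ : ‖star v * v - 1‖ < 1) (h₂ : ‖v * star v - 1‖ < 1) :
    IsUnit v := by
  have key : ∀ a : A, ‖a - 1‖ < 1 → IsUnit a := fun a h => by
    rw [norm_sub_rev] at h
    simpa using isUnit_one_sub_of_norm_lt_one h
  obtain ⟨s, hs⟩ := key _ h₁
  obtain ⟨t, ht⟩ := key _ h₂
  refine isUnit_iff_exists_and_exists.mpr ⟨⟨star v * ↑t⁻¹, ?_⟩, ⟨↑s⁻¹ * star v, ?_⟩⟩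
  · rw [← mul_assoc, ← ht, Units.mul_inv]
  · rw [mul_assoc, ← hs, Units.inv_mul]

/-- A sequence that is asymptotically unitary is asymptotic to a sequence of unitaries. -/
theorem exists_unitary_seq {v : ℕ → A} (h₁ : Tendsto (fun n => ‖star (v n) * v n - 1‖) atTop (𝓝 0))
    (h₂ : Tendsto (fun n => ‖v n * star (v n) - 1‖) atTop (𝓝 0)) :
    ∃ w : ℕ → A, (∀ n, w n ∈ unitary A) ∧ Tendsto (fun n => ‖v n - w n‖) atTop (𝓝 0) := by
  have h : ∀ n, ∃ w ∈ unitary A, IsUnit (v n) → ‖v n - w‖ ≤ ‖star (v n) * v n - 1‖ := fun n => by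
    by_cases hn : IsUnit (v n)
    · obtain ⟨w, hw, h⟩ := exists_unitary_norm_sub_le hn
      exact ⟨w, hw, fun _ => h⟩
    · exact ⟨1, one_mem _, fun h => absurd h hn⟩
  choose w hw h using h
  refine ⟨w, hw, squeeze_zero' (.of_forall fun n => norm_nonneg _) ?_ h₁⟩
  filter_upwards [h₁.eventually_lt_const one_pos, h₂.eventually_lt_const one_pos] with n hn₁ hn₂
  exact h n (isUnit_of_norm_sub_one_lt hn₁ hn₂)

/-- The elements commuting asymptotically with a bounded sequence form a closed set. -/
theorem isClosed_asymptoticCommutant {w : ℕ → A} (hw : ∀ n, ‖w n‖ ≤ 1) :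
    IsClosed {x : A | Tendsto (fun n => ‖w n * x - x * w n‖) atTop (𝓝 0)} := by
  refine isClosed_of_closure_subset fun x hx => ?_
  rw [Set.mem_ofPred_eq, Metric.tendsto_atTop]
  intro ε hε
  obtain ⟨y, hy, hxy⟩ := Metric.mem_closure_iff.mp hx (ε / 4) (by positivity)
  rw [Set.mem_ofPred_eq, Metric.tendsto_atTop] at hy
  obtain ⟨N, hN⟩ := hy (ε / 2) (by positivity)
  refine ⟨N, fun n hn => ?_⟩
  have h := hN n hn
  rw [Real.dist_0_eq_abs, abs_norm] at h ⊢
  rw [dist_eq_norm] at hxy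
  -- The outer terms are each below ε/4 uniformly in n, since ‖wₙ‖ ≤ 1; the middle one is below ε/2.
  have e : w n * x - x * w n = w n * (x - y) + (w n * y - y * w n) - (x - y) * w n := by noncomm_ring
  have h1 : ‖w n * (x - y)‖ ≤ 1 * ‖x - y‖ := norm_mul_le_of_le (hw n) le_rfl
  have h2 : ‖(x - y) * w n‖ ≤ ‖x - y‖ * 1 := norm_mul_le_of_le le_rfl (hw n)
  have h3 := norm_sub_le (w n * (x - y) + (w n * y - y * w n)) ((x - y) * w n)
  have h4 := norm_add_le (w n * (x - y)) (w n * y - y * w n)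
  rw [e]
  linarith

/-- Change one factor at a time. Applied to adjoints, the bound also compares cbc⋆ with xbx⋆. -/
theorem norm_conj_sub_conj_le (c x b : A) :
    ‖star c * b * c - star x * b * x‖ ≤ ‖c - x‖ * ‖b‖ * (‖c‖ + ‖x‖) := by
  have e : star c * b * c - star x * b * x = star c * b * (c - x) + star (c - x) * b * x := by
    rw [star_sub]; noncomm_ring
  have h1 : ‖star c * b * (c - x)‖ ≤ ‖c‖ * ‖b‖ * ‖c - x‖ :=
    norm_mul_le_of_le (norm_mul_le_of_le (norm_star c).le le_rfl) le_rfl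
  have h2 : ‖star (c - x) * b * x‖ ≤ ‖c - x‖ * ‖b‖ * ‖x‖ :=
    norm_mul_le_of_le (norm_mul_le_of_le (norm_star _).le le_rfl) le_rfl
  rw [e]
  exact (norm_add_le _ _).trans (by linarith)

end Unitary

/-! ### Averaging the dual action over roots of unity -/

/-- The primitive `N`-th root of unity `exp (2πi/N)`. -/
def Circle.root (N : ℕ) : Circle := Circle.exp (2 * Real.pi / N)

theorem Circle.isPrimitiveRoot_root {N : ℕ} (hN : N ≠ 0) :
    IsPrimitiveRoot (Circle.root N : ℂ) N := by
  convert Complex.isPrimitiveRoot_exp N hN using 1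
  rw [Circle.root, Circle.coe_exp]
  push_cast
  ring_nf

/-- A geometric sum whose ratio ωⁿ differs from 1, as N does not divide n, but has N-th power 1. -/
theorem Circle.sum_root_zpow {N : ℕ} {n : ℤ} (hn : n ≠ 0) (hN : n.natAbs < N) :
    ∑ k ∈ Finset.range N, (((Circle.root N ^ k) ^ n : Circle) : ℂ) = 0 := by
  have h := Circle.isPrimitiveRoot_root (N := N) (by omega)
  have h1 : (Circle.root N : ℂ) ^ n ≠ 1 := by
    rw [Ne, h.zpow_eq_one_iff_dvd]
    intro hd
    have := Int.natAbs_dvd_natAbs.mpr hd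
    have := Nat.le_of_dvd (by omega) this
    simp at this
    omega
  have h2 : ∀ k ∈ Finset.range N, (((Circle.root N ^ k) ^ n : Circle) : ℂ) =
      ((Circle.root N : ℂ) ^ n) ^ k := fun k _ => by
    rw [Circle.coe_zpow, Circle.coe_pow, ← zpow_natCast, ← zpow_natCast, zpow_comm]
  rw [Finset.sum_congr rfl h2, geom_sum_eq h1, ← zpow_natCast, zpow_comm, zpow_natCast,
    h.pow_eq_one, one_zpow, sub_self, zero_div]

section Averaging

variable {B : Type*} [CStarAlgebra B] (β : B ≃⋆ₐ[ℂ] B)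

/-- Once N exceeds every |n| in the finite support of f, averaging over the N-th roots of unity
kills all terms but n = 0. This replaces integration over the circle. Stating it for all large N
lets the induction combine two summands. -/
theorem ConvAlg.eventually_sum_gaugeHom (f : ConvAlg β) : ∀ᶠ N : ℕ in atTop,
    ∑ k ∈ Finset.range N, gaugeHom β (Circle.root N ^ k) f =
      (N : ℂ) • mono β 1 (coeffLin β 1 f) := by
  induction f using induct with
  | zero => simp [mono_zero]
  | mono n b =>
    rcases eq_or_ne n 1 with rfl | hn
    · refine .of_forall fun N => ?_
      simp only [gaugeHom_mono, ZAct.toInt_one, zpow_zero, Circle.coe_one, one_smul,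
        Finset.sum_const, Finset.card_range, coeffLin_mono_same, Nat.cast_smul_eq_nsmul]
    · have hn' : n.toInt ≠ 0 := hn
      filter_upwards [eventually_gt_atTop n.toInt.natAbs] with N hN
      rw [coeffLin_mono_of_ne β hn, mono_zero, smul_zero]
      simp only [gaugeHom_mono, ← smul_mono]
      rw [← Finset.sum_smul, Circle.sum_root_zpow hn' hN, zero_smul]
  | add f g hf hg =>
    filter_upwards [hf, hg] with N hf hg
    simp only [map_add, Finset.sum_add_distrib, hf, hg, mono_add, smul_add]

/-- The generator `1` of `ℤ`. -/
def ZAct.generator : ZAct β := Multiplicative.ofAdd (1 : ℤ)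

theorem ZAct.generator_smul (b : B) : generator β • b = β b :=
  congrArg (fun φ : B ≃⋆ₐ[ℂ] B => φ b) (zpow_one β)

/-! ### The copy of B, the canonical unitary and almost invariant elements -/

namespace CrossedProduct

/-- The inclusion of `B` in `B ⋊_β ℤ`. -/
def base (b : B) : CrossedProduct β := of (ConvAlg.mono β 1 b)

theorem norm_base (b : B) : ‖base β b‖ = ‖b‖ := by
  rw [base, norm_of, ConvAlg.norm_mono_one]

theorem base_mul (a b : B) : base β (a * b) = base β a * base β b := by
  rw [base, base, base, ← of_mul, ConvAlg.mono_mul, one_mul, one_smul]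

theorem base_star (b : B) : base β (star b) = star (base β b) := by
  rw [base, base, star_of, ConvAlg.star_mono, inv_one, one_smul]

theorem base_one : base β (1 : B) = 1 := rfl

theorem base_sub (a b : B) : base β (a - b) = base β a - base β b := by
  rw [eq_sub_iff_add_eq, base, base, base, ← of_add, ← ConvAlg.mono_add, sub_add_cancel]

/-- The canonical unitary of `B ⋊_β ℤ`. -/
def canonicalUnitary : CrossedProduct β := of (ConvAlg.mono β (ZAct.generator β) 1)

theorem canonicalUnitary_mem : canonicalUnitary β ∈ unitary (CrossedProduct β) := by
  rw [Unitary.mem_iff, canonicalUnitary, star_of, ← of_mul, ← of_mul, ConvAlg.star_mono,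
    ConvAlg.mono_mul, ConvAlg.mono_mul, mul_inv_cancel, inv_mul_cancel, star_one, smul_one, smul_one,
    one_mul]
  exact ⟨rfl, rfl⟩

theorem canonicalUnitary_mul_base (b : B) :
    canonicalUnitary β * base β b = base β (β b) * canonicalUnitary β := by
  rw [canonicalUnitary, base, base, ← of_mul, ← of_mul, ConvAlg.mono_mul, ConvAlg.mono_mul, one_mul,
    mul_one, one_mul, one_smul, mul_one, ZAct.generator_smul]

theorem gauge_base (ζ : Circle) (b : B) : gauge β ζ (base β b) = base β b := by
  rw [base, gauge_of, ConvAlg.gaugeHom_mono]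
  simp

theorem gauge_canonicalUnitary (ζ : Circle) :
    gauge β ζ (canonicalUnitary β) = (ζ : ℂ) • canonicalUnitary β := by
  rw [canonicalUnitary, gauge_of, ConvAlg.gaugeHom_mono, ← of_smul, ConvAlg.smul_mono]
  congr 4
  exact zpow_one ζ

theorem gauge_mul (ζ : Circle) (x y : CrossedProduct β) :
    gauge β ζ (x * y) = gauge β ζ x * gauge β ζ y := map_mul (gaugeAut β ζ) x y

theorem gauge_sub (ζ : Circle) (x y : CrossedProduct β) :
    gauge β ζ (x - y) = gauge β ζ x - gauge β ζ y := map_sub (gaugeAut β ζ) x y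

theorem gauge_star (ζ : Circle) (x : CrossedProduct β) :
    gauge β ζ (star x) = star (gauge β ζ x) := map_star (gaugeAut β ζ) x

theorem norm_gauge (ζ : Circle) (x : CrossedProduct β) : ‖gauge β ζ x‖ = ‖x‖ :=
  NonUnitalStarAlgHom.norm_map (gaugeAut β ζ : CrossedProduct β →⋆ₙₐ[ℂ] CrossedProduct β)
    (gaugeAut β ζ).injective x

/-- An element that is almost invariant under the dual action is close to `B`. -/
theorem exists_norm_sub_base_lt {x : CrossedProduct β} {ε : ℝ} (hε : 0 < ε)
    (hx : ∀ ζ, ‖gauge β ζ x - x‖ < ε) : ∃ b : B, ‖base β b - x‖ ≤ 2 * ε := by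
  obtain ⟨f, hf⟩ : ∃ f : ConvAlg β, dist x (of f) < ε :=
    (UniformSpace.Completion.denseRange_coe (α := ConvAlg β)).exists_dist_lt x hε
  rw [dist_eq_norm] at hf
  obtain ⟨N, hN, hN0⟩ := ((ConvAlg.eventually_sum_gaugeHom β f).and (eventually_gt_atTop 0)).exists
  -- The witness is the zeroth coefficient of a finite sum f near x, so the conditional expectation
  -- need not be extended to the completion.
  refine ⟨ConvAlg.coeffLin β 1 f, ?_⟩
  have hN' : (0 : ℝ) < N := by exact_mod_cast hN0
  have hof : ∀ s : Finset ℕ, of (∑ k ∈ s, ConvAlg.gaugeHom β (Circle.root N ^ k) f) =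
      ∑ k ∈ s, gauge β (Circle.root N ^ k) (of f) := fun s => by
    simp only [gauge_of]
    exact map_sum ({ toFun := of, map_zero' := rfl, map_add' := of_add β } :
      ConvAlg β →+ CrossedProduct β) _ _
  have key : (N : ℂ) • (base β (ConvAlg.coeffLin β 1 f) - x) =
      ∑ k ∈ Finset.range N, (gauge β (Circle.root N ^ k) (of f) - x) := by
    rw [smul_sub, base, ← of_smul, ← hN, hof, Finset.sum_sub_distrib, Finset.sum_const,
      Finset.card_range, Nat.cast_smul_eq_nsmul]
  have hk : ∀ k ∈ Finset.range N, ‖gauge β (Circle.root N ^ k) (of f) - x‖ ≤ 2 * ε := fun k _ => by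
    -- One ε comes from the almost invariance of x and one from replacing x by f; together they give
    -- 2ε.
    have e : gauge β (Circle.root N ^ k) (of f) - x =
        (gauge β (Circle.root N ^ k) x - x) - gauge β (Circle.root N ^ k) (x - of f) := by
      rw [gauge_sub]; abel
    rw [e]
    refine (norm_sub_le _ _).trans ?_
    rw [norm_gauge]
    linarith [hx (Circle.root N ^ k)]
  have h := norm_sum_le_of_le _ hk
  rw [← key, norm_smul, Complex.norm_natCast, Finset.sum_const, Finset.card_range,
    nsmul_eq_mul] at h
  exact le_of_mul_le_mul_left h hN'

end CrossedProduct

end Averaging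

/-! ### Approximate representability in terms of sequences -/

namespace SeqAlgebra

variable {A : Type*} [CStarAlgebra A] [Nontrivial A]

theorem mk_eq_mk_iff {a b : BoundedSeq A} :
    SeqAlgebra.mk A a = SeqAlgebra.mk A b ↔ Tendsto (fun n => ‖a n - b n‖) atTop (𝓝 0) := by
  rw [Ideal.Quotient.eq, mem_nullSeqIdeal]
  rfl

theorem star_mk (a : BoundedSeq A) : star (SeqAlgebra.mk A a) = SeqAlgebra.mk A (star a) := rfl

theorem map_mk (φ : A ≃⋆ₐ[ℂ] A) (a : BoundedSeq A) :
    SeqAlgebra.map φ (SeqAlgebra.mk A a) = SeqAlgebra.mk A (mapSeq φ a) := rfl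

theorem mk_mem_unitary_iff {a : BoundedSeq A} : SeqAlgebra.mk A a ∈ unitary (SeqAlgebra A) ↔
    Tendsto (fun n => ‖star (a n) * a n - 1‖) atTop (𝓝 0) ∧
      Tendsto (fun n => ‖a n * star (a n) - 1‖) atTop (𝓝 0) := by
  rw [Unitary.mem_iff, star_mk, ← map_mul, ← map_mul, ← map_one (SeqAlgebra.mk A), mk_eq_mk_iff,
    mk_eq_mk_iff]
  simp [lp.infty_coeFn_mul, lp.infty_coeFn_one]

theorem map_mk_eq_iff {φ : A ≃⋆ₐ[ℂ] A} {a : BoundedSeq A} :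
    SeqAlgebra.map φ (SeqAlgebra.mk A a) = SeqAlgebra.mk A a ↔
      Tendsto (fun n => ‖φ (a n) - a n‖) atTop (𝓝 0) := by
  rw [map_mk, mk_eq_mk_iff]
  rfl

theorem const_eq_conj_iff {a : BoundedSeq A} {b c : A} :
    SeqAlgebra.const A b = SeqAlgebra.mk A a * SeqAlgebra.const A c * star (SeqAlgebra.mk A a) ↔
      Tendsto (fun n => ‖b - a n * c * star (a n)‖) atTop (𝓝 0) := by
  rw [star_mk, const, const, ← map_mul, ← map_mul, mk_eq_mk_iff]
  simp [lp.infty_coeFn_mul, constSeq]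

end SeqAlgebra

/-! ### The duality theorem -/

section Duality

variable {B : Type*} [CStarAlgebra B] (β : B ≃⋆ₐ[ℂ] B)

open CrossedProduct

/-! ### From approximate representability to the Rokhlin property -/

theorem norm_starAlgEquiv_apply (φ : B ≃⋆ₐ[ℂ] B) (b : B) : ‖φ b‖ = ‖b‖ :=
  NonUnitalStarAlgHom.norm_map (φ : B →⋆ₙₐ[ℂ] B) φ.injective b

/-- A sequence that is asymptotically fixed by `β` is asymptotically fixed by every power of `β`. -/
theorem tendsto_norm_zpow_apply_sub {v : ℕ → B}
    (hv : Tendsto (fun k => ‖β (v k) - v k‖) atTop (𝓝 0)) (n : ℤ) :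
    Tendsto (fun k => ‖(β ^ n) (v k) - v k‖) atTop (𝓝 0) := by
  -- As βⁿ is isometric, consecutive powers move vₖ by the same amount; the triangle inequality then
  -- handles each fixed power.
  have step : ∀ (n : ℤ) (k : ℕ),
      ‖(β ^ (n + 1)) (v k) - (β ^ n) (v k)‖ = ‖β (v k) - v k‖ := fun n k => by
    rw [zpow_add_one, StarAlgEquiv.mul_apply, ← map_sub, norm_starAlgEquiv_apply]
  induction n using Int.induction_on with
  | zero => simp
  | succ n ih =>
    refine squeeze_zero (fun _ => norm_nonneg _) (fun k => ?_) (add_zero (0 : ℝ) ▸ hv.add ih)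
    rw [← step n k]
    exact norm_sub_le_norm_sub_add_norm_sub _ _ _
  | pred n ih =>
    refine squeeze_zero (fun _ => norm_nonneg _) (fun k => ?_) (add_zero (0 : ℝ) ▸ hv.add ih)
    rw [← step (-n - 1) k, sub_add_cancel, norm_sub_rev ((β ^ (-(n : ℤ))) (v k))]
    exact norm_sub_le_norm_sub_add_norm_sub _ _ _

theorem base_mem_unitary {b : B} (hb : b ∈ unitary B) : base β b ∈ unitary (CrossedProduct β) := by
  rw [Unitary.mem_iff] at hb ⊢
  rw [← base_star, ← base_mul, ← base_mul, hb.1, hb.2]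
  exact ⟨rfl, rfl⟩

instance CrossedProduct.instNontrivial [Nontrivial B] : Nontrivial (CrossedProduct β) :=
  ⟨base β 1, 0, fun h => by simpa [norm_base] using congrArg norm h⟩

/-- The commutator of v⋆u with buⁿ is the single term (v⋆β(b) − bβⁿ(v⋆))uⁿ⁺¹. Inserting bv⋆ splits
it into the defect of v in implementing β and its defect in being fixed by βⁿ. -/
theorem norm_commutator_mono_le {v : B} (hv : v ∈ unitary B) (n : ZAct β) (b : B) :
    ‖base β (star v) * canonicalUnitary β * of (ConvAlg.mono β n b) -
        of (ConvAlg.mono β n b) * (base β (star v) * canonicalUnitary β)‖ ≤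
      ‖β b - v * b * star v‖ + ‖b‖ * ‖(β ^ n.toInt) v - v‖ := by
  have e : base β (star v) * canonicalUnitary β * of (ConvAlg.mono β n b) -
      of (ConvAlg.mono β n b) * (base β (star v) * canonicalUnitary β) =
      of (ConvAlg.mono β (n * ZAct.generator β) (star v * β b - b * n • star v)) := by
    rw [base, canonicalUnitary, ← of_mul, ← of_mul, ← of_mul, ConvAlg.mono_mul, ConvAlg.mono_mul,
      ConvAlg.mono_mul, one_smul, one_mul, mul_one, ZAct.generator_smul, mul_comm n,
      sub_eq_iff_eq_add, ← of_add, ← ConvAlg.mono_add, sub_add_cancel]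
  rw [e, norm_of]
  refine (ConvAlg.norm_mono_le β _ _).trans ?_
  have h1 : ‖star v * β b - b * star v‖ = ‖β b - v * b * star v‖ := by
    rw [← CStarRing.norm_mem_unitary_mul _ hv, mul_sub, ← mul_assoc, (Unitary.mem_iff.mp hv).2,
      one_mul, mul_assoc]
  have h2 : ‖b * star v - b * n • star v‖ ≤ ‖b‖ * ‖(β ^ n.toInt) v - v‖ := by
    rw [← mul_sub, ZAct.smul_star, ← star_sub, ← ZAct.smul_def, norm_sub_rev (n • v),
      ← norm_star (v - n • v)]
    exact norm_mul_le _ _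
  rw [← h1]
  exact (norm_sub_le_norm_sub_add_norm_sub _ (b * star v) _).trans (by gcongr)

theorem IsApproxRepresentable.hasRokhlinProperty [Nontrivial B] {β : B ≃⋆ₐ[ℂ] B}
    (h : IsApproxRepresentable β) : (dualAction β).HasRokhlinProperty := by
  obtain ⟨a', ha, hfix, hconj⟩ := h
  obtain ⟨a, rfl⟩ := Ideal.Quotient.mk_surjective a'
  rw [SeqAlgebra.mk_mem_unitary_iff] at ha
  rw [SeqAlgebra.map_mk_eq_iff] at hfix
  simp only [SeqAlgebra.const_eq_conj_iff] at hconj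
  obtain ⟨v, hv, hva⟩ := exists_unitary_seq ha.1 ha.2
  have hvn : ∀ n, ‖v n‖ = 1 := fun n => CStarRing.norm_of_mem_unitary (hv n)
  have han : ∀ n, ‖a n‖ ≤ ‖a‖ := lp.norm_apply_le_norm (by simp) a
  have hvfix : Tendsto (fun n => ‖β (v n) - v n‖) atTop (𝓝 0) := by
    refine squeeze_zero (fun _ => norm_nonneg _) (fun n => ?_)
      (by simpa using (hva.add hfix).add hva)
    have e : β (v n) - v n = (β (a n) - a n) - β (a n - v n) + (a n - v n) := by
      rw [map_sub]; abel
    rw [e]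
    refine (norm_add_le _ _).trans (add_le_add_left ((norm_sub_le _ _).trans_eq ?_) _)
    rw [norm_starAlgEquiv_apply, add_comm]
  have hvconj : ∀ b, Tendsto (fun n => ‖β b - v n * b * star (v n)‖) atTop (𝓝 0) := fun b => by
    have h1 := (hva.mul_const (‖b‖ * (‖a‖ + 1))).add (hconj b)
    rw [zero_mul, zero_add] at h1
    refine squeeze_zero (fun _ => norm_nonneg _) (fun n => ?_) h1
    have h2 := norm_conj_sub_conj_le (star (a n)) (star (v n)) b
    rw [star_star, star_star, ← star_sub, norm_star, norm_star, norm_star, hvn,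
      mul_assoc ‖a n - v n‖] at h2
    have h3 : ‖a n - v n‖ * (‖b‖ * (‖a n‖ + 1)) ≤ ‖a n - v n‖ * (‖b‖ * (‖a‖ + 1)) := by
      gcongr; exact han n
    rw [add_comm]
    exact (norm_sub_le_norm_sub_add_norm_sub _ (a n * b * star (a n)) _).trans
      (add_le_add_right (h2.trans h3) _)
  set w : ℕ → CrossedProduct β := fun n => base β (star (v n)) * canonicalUnitary β with hwdef
  have hw : ∀ n, w n ∈ unitary (CrossedProduct β) := fun n =>
    mul_mem (base_mem_unitary β (Unitary.star_mem (hv n))) (canonicalUnitary_mem β)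
  have hcomm : ∀ x, Tendsto (fun n => ‖w n * x - x * w n‖) atTop (𝓝 0) := fun x => by
    -- The asymptotic commutant is closed, so finite sums suffice, and by additivity single terms
    -- buᵐ.
    induction x using CrossedProduct.induct with
    | closed =>
      exact isClosed_asymptoticCommutant fun n => CStarRing.norm_of_mem_unitary (hw n) |>.le
    | of f =>
      induction f using ConvAlg.induct with
      | zero =>
        change Tendsto (fun n => ‖w n * 0 - 0 * w n‖) atTop (𝓝 0)
        simp
      | mono m b =>
        have h1 := (hvconj b).add ((tendsto_norm_zpow_apply_sub β hvfix m.toInt).const_mul ‖b‖)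
        rw [mul_zero, zero_add] at h1
        exact squeeze_zero (fun _ => norm_nonneg _)
          (fun n => norm_commutator_mono_le β (hv n) m b) h1
      | add f g hf hg =>
        refine squeeze_zero (fun _ => norm_nonneg _) (fun n => ?_) (by simpa using hf.add hg)
        rw [of_add, mul_add, add_mul, add_sub_add_comm]
        exact norm_add_le _ _
  intro ε hε F
  obtain ⟨n, hn⟩ := ((eventually_all_finset F).mpr fun x _ =>
    (hcomm x).eventually_lt_const hε).exists
  refine ⟨w n, hw n, fun ζ => ?_, hn⟩
  change ‖gauge β ζ (w n) - (ζ : ℂ) • w n‖ < ε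
  rw [hwdef, gauge_mul, gauge_base, gauge_canonicalUnitary, mul_smul_comm, sub_self, norm_zero]
  exact hε

/-! ### From the Rokhlin property to approximate representability -/

/-- A Rokhlin unitary for the dual action yields an element of `B` close to its product with the
adjoint of the canonical unitary. -/
theorem exists_norm_base_sub_le {w : CrossedProduct β} {ε : ℝ} (hε : 0 < ε)
    (h : ∀ ζ : Circle, ‖gauge β ζ w - (ζ : ℂ) • w‖ < ε) :
    ∃ c : B, ‖base β c - w * star (canonicalUnitary β)‖ ≤ 2 * ε := by
  refine exists_norm_sub_base_lt β hε fun ζ => ?_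
  have hu := Unitary.star_mem (canonicalUnitary_mem β)
  have hζ : (ζ : ℂ) * star (ζ : ℂ) = 1 := by
    rw [Complex.star_def, Complex.mul_conj, Circle.normSq_coe, Complex.ofReal_one]
  -- The dual action multiplies u⋆ by the conjugate of ζ, cancelling the factor ζ that w
  -- approximately acquires.
  have e : gauge β ζ (w * star (canonicalUnitary β)) - w * star (canonicalUnitary β) =
      star (ζ : ℂ) • ((gauge β ζ w - (ζ : ℂ) • w) * star (canonicalUnitary β)) := by
    rw [gauge_mul, gauge_star, gauge_canonicalUnitary, star_smul, sub_mul, smul_sub, mul_smul_comm,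
      smul_mul_assoc, smul_smul, mul_comm (star (ζ : ℂ)), hζ, one_smul]
  rw [e, norm_smul, norm_star, Circle.norm_coe, one_mul, CStarRing.norm_mul_mem_unitary _ hu]
  exact h ζ

variable {A : Type*} [CStarAlgebra A]

/-- For x = wu⋆ one has x⋆bx = u(w⋆bw)u⋆, so x⋆ implements conjugation by u up to the commutator of
w with b. -/
theorem norm_conj_mul_star_sub_conj {w u : A} (hw : w ∈ unitary A) (hu : u ∈ unitary A) (b : A) :
    ‖star (w * star u) * b * (w * star u) - u * b * star u‖ = ‖w * b - b * w‖ := by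
  have e : star (w * star u) * b * (w * star u) - u * b * star u =
      u * (star w * (b * w - w * b)) * star u := by
    rw [star_mul, star_star, mul_sub, ← mul_assoc (star w) w, (Unitary.mem_iff.mp hw).1]
    noncomm_ring
  rw [e, CStarRing.norm_mul_mem_unitary _ (Unitary.star_mem hu), CStarRing.norm_mem_unitary_mul _ hu,
    CStarRing.norm_mem_unitary_mul _ (Unitary.star_mem hw), norm_sub_rev]

theorem norm_conj_mul_star_sub_self (w : A) {u : A} (hu : u ∈ unitary A) :
    ‖u * (w * star u) * star u - w * star u‖ = ‖w * u - u * w‖ := by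
  have e : u * (w * star u) * star u - w * star u = (u * w - w * u) * star u * star u := by
    have := (Unitary.mem_iff.mp hu).2
    simp only [sub_mul, mul_assoc, this, mul_one]
  rw [e, CStarRing.norm_mul_mem_unitary _ (Unitary.star_mem hu),
    CStarRing.norm_mul_mem_unitary _ (Unitary.star_mem hu), norm_sub_rev]

theorem IsApproxRepresentable.of_hasRokhlinProperty [Nontrivial B]
    [TopologicalSpace.SeparableSpace B] {β : B ≃⋆ₐ[ℂ] B}
    (h : (dualAction β).HasRokhlinProperty) : IsApproxRepresentable β := by
  classical
  set u := canonicalUnitary β with hudef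
  have hu : u ∈ unitary (CrossedProduct β) := canonicalUnitary_mem β
  obtain ⟨d, hd⟩ := TopologicalSpace.exists_dense_seq B
  have hε : ∀ n : ℕ, (0 : ℝ) < 1 / ((n : ℝ) + 1) := fun n => Nat.one_div_pos_of_nat
  have hε0 : Tendsto (fun n : ℕ => 1 / ((n : ℝ) + 1)) atTop (𝓝 0) :=
    tendsto_one_div_add_atTop_nhds_zero_nat
  -- The n-th finite set contains u and d₀, …, dₙ, so each dₖ is tested from n = k on. Density of d
  -- then gives asymptotic commutation with all of B, which is where separability enters.
  choose w hw hgauge hF using fun n : ℕ => h _ (hε n)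
    (insert u ((Finset.range (n + 1)).image fun k => base β (d k)))
  choose c hc using fun n => exists_norm_base_sub_le β (hε n) (hgauge n)
  have hwu : Tendsto (fun n => ‖w n * u - u * w n‖) atTop (𝓝 0) :=
    squeeze_zero (fun _ => norm_nonneg _) (fun n => (hF n u (Finset.mem_insert_self _ _)).le) hε0
  have hwb : ∀ b, Tendsto (fun n => ‖w n * base β b - base β b * w n‖) atTop (𝓝 0) := by
    have hcont : Continuous (base β) :=
      (UniformSpace.Completion.continuous_coe (ConvAlg β)).comp (ConvAlg.continuous_mono β 1)
    have hcl := (isClosed_asymptoticCommutant (w := w)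
      fun n => (CStarRing.norm_of_mem_unitary (hw n)).le).preimage hcont
    intro b
    refine hcl.closure_subset_iff.mpr ?_ (hd b)
    rintro _ ⟨k, rfl⟩
    refine squeeze_zero' (.of_forall fun _ => norm_nonneg _) ?_ hε0
    filter_upwards [eventually_ge_atTop k] with n hn
    exact (hF n _ (Finset.mem_insert_of_mem (Finset.mem_image_of_mem _
      (Finset.mem_range.mpr (by omega))))).le
  set x : ℕ → CrossedProduct β := fun n => w n * star u with hxdef
  have hx : ∀ n, x n ∈ unitary (CrossedProduct β) := fun n => mul_mem (hw n) (Unitary.star_mem hu)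
  have hxn : ∀ n, ‖x n‖ = 1 := fun n => CStarRing.norm_of_mem_unitary (hx n)
  have hcx : Tendsto (fun n => ‖base β (c n) - x n‖) atTop (𝓝 0) :=
    squeeze_zero (fun _ => norm_nonneg _) hc (by simpa using hε0.const_mul 2)
  -- The bound 3 is ‖xₙ‖ = 1 plus the error 2/(n + 1) ≤ 2.
  have hcn : ∀ n, ‖base β (c n)‖ ≤ 3 := fun n => by
    have h1 : 1 / ((n : ℝ) + 1) ≤ 1 := by
      rw [div_le_one (by positivity)]; linarith [(Nat.cast_nonneg n : (0 : ℝ) ≤ n)]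
    have h2 := norm_sub_norm_le (base β (c n)) (x n)
    have h3 := hc n
    rw [hxn] at h2
    linarith
  have hconj : ∀ b, Tendsto (fun n => ‖star (base β (c n)) * b * base β (c n) -
      star (x n) * b * x n‖) atTop (𝓝 0) := fun b => by
    have h1 := hcx.mul_const (‖b‖ * (3 + 1))
    rw [zero_mul] at h1
    refine squeeze_zero (fun _ => norm_nonneg _) (fun n => ?_) h1
    refine (norm_conj_sub_conj_le _ _ _).trans ?_
    rw [hxn, mul_assoc]
    gcongr
    exact hcn n
  -- Adjoints are taken because xₙ⋆, rather than xₙ, asymptotically implements β.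
  let v : BoundedSeq B := ⟨fun n => star (c n), memℓp_infty ⟨3, by
    rintro _ ⟨n, rfl⟩
    simpa [norm_base] using hcn n⟩⟩
  have hv : ∀ n, v n = star (c n) := fun n => rfl
  refine ⟨SeqAlgebra.mk B v, ?_, ?_, fun b => ?_⟩
  · rw [SeqAlgebra.mk_mem_unitary_iff]
    simp only [hv, star_star]
    constructor
    · have h1 := hcx.mul_const (3 + 1)
      rw [zero_mul] at h1
      refine squeeze_zero (fun _ => norm_nonneg _) (fun n => ?_) h1
      -- Isometry of B → B ⋊ ℤ moves the estimate to the crossed product, where cₙ is compared with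
      -- the unitary xₙ.
      rw [← norm_base β, base_sub, base_mul, base_star, base_one]
      have h2 := norm_conj_sub_conj_le (star (base β (c n))) (star (x n)) 1
      rw [star_star, star_star, mul_one, mul_one, (Unitary.mem_iff.mp (hx n)).2, ← star_sub,
        norm_star, norm_star, norm_star, hxn, norm_one, mul_one] at h2
      refine h2.trans ?_
      gcongr
      exact hcn n
    · refine (hconj 1).congr fun n => ?_
      rw [← norm_base β, base_sub, base_mul, base_star, base_one, mul_one, mul_one,
        (Unitary.mem_iff.mp (hx n)).1]
  · rw [SeqAlgebra.map_mk_eq_iff]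
    simp only [hv]
    refine squeeze_zero (fun _ => norm_nonneg _) (fun n => ?_)
      (by simpa using (hcx.add hwu).add hcx)
    rw [map_star, ← star_sub, norm_star, ← norm_base β, base_sub]
    have e : base β (β (c n)) = u * base β (c n) * star u := by
      rw [hudef, canonicalUnitary_mul_base, mul_assoc, (Unitary.mem_iff.mp hu).2, mul_one]
    -- Replacing cₙ by xₙ costs two small errors; the remaining term is the commutator of wₙ with u.
    have e2 : u * base β (c n) * star u - base β (c n) = u * (base β (c n) - x n) * star u +
        (u * x n * star u - x n) - (base β (c n) - x n) := by
      rw [mul_sub, sub_mul]; abel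
    rw [e, e2]
    refine (norm_sub_le _ _).trans (add_le_add_left ((norm_add_le _ _).trans_eq ?_) _)
    rw [CStarRing.norm_mul_mem_unitary _ (Unitary.star_mem hu), CStarRing.norm_mem_unitary_mul _ hu,
      norm_conj_mul_star_sub_self (w n) hu]
  · rw [SeqAlgebra.const_eq_conj_iff]
    simp only [hv, star_star]
    refine squeeze_zero (fun _ => norm_nonneg _) (fun n => ?_)
      (by simpa using (hconj (base β b)).add (hwb b))
    have e : base β (β b) = u * base β b * star u := by
      rw [hudef, canonicalUnitary_mul_base, mul_assoc, (Unitary.mem_iff.mp hu).2, mul_one]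
    rw [norm_sub_rev, ← norm_base β, base_sub, base_mul, base_mul, base_star, e,
      ← norm_conj_mul_star_sub_conj (hw n) hu]
    exact norm_sub_le_norm_sub_add_norm_sub _ _ _

end Duality

theorem mainTheorem9 {B : Type*} [CStarAlgebra B] [Nontrivial B]
    [TopologicalSpace.SeparableSpace B] (β : B ≃⋆ₐ[ℂ] B) :
    IsApproxRepresentable β ↔ (dualAction β).HasRokhlinProperty :=
  ⟨IsApproxRepresentable.hasRokhlinProperty, IsApproxRepresentable.of_hasRokhlinProperty⟩
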